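/- Let $\mathcal H$ be a complex Hilbert space and let $A\subseteq \mathbf B(\mathcal H)$ be a $C^*$-algebra acting nondegenerately on $\mathcal H$ (that is, a norm-closed $*$-subalgebra such that the vectors $a\varphi$, $a\in A$, $\varphi\in\mathcal H$, span a dense subspace of $\mathcal H$). Let $$M(A)=\{x\in\mathbf B(\mathcal H): xA\subseteq A,\ Ax\subseteq A\}$$ be its multiplier algebra. A densely defined closed operator $t$ on $\mathcal H$ is called *affiliated with $A$* (in the sense of Woronowicz) if its bounded transform $z_t=t(I+t^*t)^{-1/2}$ belongs to $M(A)$ and $(I+t^*t)^{-1}A$ is norm dense in $A$. **Theorem.** Let $t$ be a densely defined closed operator on $\mathcal H$ and let $\lambda$ be in the resolvent set $\rho(t)$, that is, $t-\lambda I$ is a bijection of the domain of $t$ onto $\mathcal H$ with bounded inverse. Then $t$ is affiliated with $A$ if and only if $(t-\lambda I)^{-1}\in M(A)$ and both sets $(t-\lambda I)^{-1}A$ and $(t^*-\overline\lambda I)^{-1}A$ are norm dense in $A$. -/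

import Mathlib

noncomputable section

/-! Unbounded operators on a complex Hilbert space `H` are partially defined linear maps
`t : H →ₗ.[ℂ] H`; `t.adjoint` is the Hilbert space adjoint and `t.IsClosed` says that the graph of
`t` is closed. -/

namespace UnboundedOperator

variable {H : Type*} [NormedAddCommGroup H] [InnerProductSpace ℂ H]

/-- `R` is an everywhere defined bounded two-sided inverse of the unbounded operator `T`: it maps
`H` into the domain of `T`, `T R y = y` for all `y` in `H`, and `R T x = x` for all `x` in the
domain of `T`. -/
def IsBoundedInverse (T : H →ₗ.[ℂ] H) (R : H →L[ℂ] H) : Prop :=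
  (∀ y : H, ∃ h : R y ∈ T.domain, T ⟨R y, h⟩ = y) ∧ ∀ x : T.domain, R (T x) = x

theorem IsBoundedInverse.unique {T : H →ₗ.[ℂ] H} {R S : H →L[ℂ] H}
    (hR : IsBoundedInverse T R) (hS : IsBoundedInverse T S) : R = S := by
  ext y
  obtain ⟨h, hy⟩ := hS.1 y
  have := hR.2 ⟨S y, h⟩
  rwa [hy] at this

/-- The operator `t - μ I`, with the same domain as `t`. -/
def subScalar (t : H →ₗ.[ℂ] H) (μ : ℂ) : H →ₗ.[ℂ] H where
  domain := t.domain
  toFun := t.toFun - μ • t.domain.subtype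

/-- The resolvent set `ρ(t)`: all `μ` for which `t - μ I` is a bijection of the domain of `t` onto
`H` with bounded inverse. -/
def resolventSet (t : H →ₗ.[ℂ] H) : Set ℂ :=
  {μ | ∃ R : H →L[ℂ] H, IsBoundedInverse (subScalar t μ) R}

open scoped Classical in
/-- The resolvent `(t - μ I)⁻¹` for `μ` in the resolvent set of `t`
(the value is `0` outside of the resolvent set). -/
def resolvent (t : H →ₗ.[ℂ] H) (μ : ℂ) : H →L[ℂ] H :=
  if h : ∃ R : H →L[ℂ] H, IsBoundedInverse (subScalar t μ) R then h.choose else 0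

theorem isBoundedInverse_resolvent {t : H →ₗ.[ℂ] H} {μ : ℂ} (h : μ ∈ resolventSet t) :
    IsBoundedInverse (subScalar t μ) (resolvent t μ) := by
  have h' : ∃ R : H →L[ℂ] H, IsBoundedInverse (subScalar t μ) R := h
  rw [resolvent, dif_pos h']
  exact h'.choose_spec

variable [CompleteSpace H]

/-- The operator `I + t* t`, whose domain consists of all `x` in the domain of `t` for which `t x`
lies in the domain of `t*`. -/
def oneAddAdjointMul (t : H →ₗ.[ℂ] H) : H →ₗ.[ℂ] H where
  domain :=
    { carrier := {x | ∃ h : x ∈ t.domain, t ⟨x, h⟩ ∈ t.adjoint.domain}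
      zero_mem' := ⟨t.domain.zero_mem, by
        have : t ⟨0, t.domain.zero_mem⟩ = 0 := t.map_zero
        rw [this]
        exact t.adjoint.domain.zero_mem⟩
      add_mem' := by
        rintro x y ⟨hx, hx'⟩ ⟨hy, hy'⟩
        refine ⟨t.domain.add_mem hx hy, ?_⟩
        have : t ⟨x + y, t.domain.add_mem hx hy⟩ = t ⟨x, hx⟩ + t ⟨y, hy⟩ :=
          t.map_add ⟨x, hx⟩ ⟨y, hy⟩
        rw [this]
        exact t.adjoint.domain.add_mem hx' hy'
      smul_mem' := by
        rintro c x ⟨hx, hx'⟩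
        refine ⟨t.domain.smul_mem c hx, ?_⟩
        have : t ⟨c • x, t.domain.smul_mem c hx⟩ = c • t ⟨x, hx⟩ := t.map_smul c ⟨x, hx⟩
        rw [this]
        exact t.adjoint.domain.smul_mem c hx' }
  toFun :=
    { toFun := fun x => (x : H) + t.adjoint ⟨t ⟨x, x.2.1⟩, x.2.2⟩
      map_add' := by
        intro x y
        have h : (⟨t ⟨((x + y : _) : H), (x + y).2.1⟩, (x + y).2.2⟩ : t.adjoint.domain) =
            ⟨t ⟨x, x.2.1⟩, x.2.2⟩ + ⟨t ⟨y, y.2.1⟩, y.2.2⟩ :=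
          Subtype.ext (t.map_add ⟨x, x.2.1⟩ ⟨y, y.2.1⟩)
        rw [h, t.adjoint.map_add, Submodule.coe_add]
        abel
      map_smul' := by
        intro c x
        have h : (⟨t ⟨((c • x : _) : H), (c • x).2.1⟩, (c • x).2.2⟩ : t.adjoint.domain) =
            c • ⟨t ⟨x, x.2.1⟩, x.2.2⟩ :=
          Subtype.ext (t.map_smul c ⟨x, x.2.1⟩)
        rw [h, t.adjoint.map_smul, Submodule.coe_smul, RingHom.id_apply, smul_add] }

/-- `z` is the bounded operator `t s`, defined on all of `H`; it is used with `s` the positive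
square root of `(I + t* t)⁻¹`, in which case `z` is the bounded transform `t (I + t* t)^(-1/2)`. -/
def IsBoundedProduct (t : H →ₗ.[ℂ] H) (s z : H →L[ℂ] H) : Prop :=
  ∀ x : H, ∃ h : s x ∈ t.domain, t ⟨s x, h⟩ = z x

end UnboundedOperator

namespace OperatorAlgebra

open UnboundedOperator

variable {H : Type*} [NormedAddCommGroup H] [InnerProductSpace ℂ H] [CompleteSpace H]

/-- A set `A` of bounded operators acts nondegenerately on `H`: the vectors `a x` with `a ∈ A` and
`x ∈ H` span a dense subspace. -/
def Nondegenerate (A : NonUnitalStarSubalgebra ℂ (H →L[ℂ] H)) : Prop :=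
  Dense (Submodule.span ℂ {y : H | ∃ a ∈ A, ∃ x : H, a x = y} : Set H)

/-- The multiplier algebra `M(A) = {x ∈ B(H) : x A ⊆ A, A x ⊆ A}` of a nondegenerate C*-algebra
`A` of operators on `H`. -/
def multiplierAlgebra (A : NonUnitalStarSubalgebra ℂ (H →L[ℂ] H)) : Set (H →L[ℂ] H) :=
  {x | ∀ a ∈ A, x * a ∈ A ∧ a * x ∈ A}

/-- The set `x A` is (contained and) norm dense in the norm closed algebra `A`. -/
def MulDense (x : H →L[ℂ] H) (A : NonUnitalStarSubalgebra ℂ (H →L[ℂ] H)) : Prop :=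
  closure ((fun a => x * a) '' (A : Set (H →L[ℂ] H))) = A

/-- A densely defined closed operator `t` is affiliated with `A` in the sense of Woronowicz: its
bounded transform `z = t (I + t* t)^(-1/2)` lies in `M(A)`, and `r A` is dense in `A`, where
`r = (I + t* t)⁻¹ = I - z* z`. -/
def IsAffiliated (t : H →ₗ.[ℂ] H) (A : NonUnitalStarSubalgebra ℂ (H →L[ℂ] H)) : Prop :=
  Dense (t.domain : Set H) ∧ t.IsClosed ∧
    ∃ r z : H →L[ℂ] H, IsBoundedInverse (oneAddAdjointMul t) r ∧
      IsBoundedProduct t (CFC.sqrt r) z ∧ z ∈ multiplierAlgebra A ∧ MulDense r A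

end OperatorAlgebra

end

noncomputable section

open scoped ComplexOrder InnerProductSpace

namespace UnboundedOperator

variable {H : Type*} [NormedAddCommGroup H] [InnerProductSpace ℂ H]

/-! Write `R` for the resolvent, `r = (I + t* t)⁻¹`, `s = √r`, `z = t s`.

Suppose `R ∈ M(A)` with `R A` and `R* A` dense. The graph of `t` is parametrized by `u ↦ (R u, u + μ
R u)`. Its Gram operator `G` is invertible (`isUnit_graphGram`), and `r = R G⁻¹ R*`. As `M(A)` is a
norm closed star algebra, it contains `G⁻¹`, `r` and `s`, and density of `r A` follows factor by
factor. Both `z s = (1 + μ R) G⁻¹ R*` and `R z = s + μ R s` lie in `M(A)`; density of `s A` and `R*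
A` cancels the extra factors (`MulDense.mul_mem_of_mul`), so `z ∈ M(A)`.

Conversely, `v = z - μ s` lies in `M(A)` and satisfies `R v = s`. It is invertible with inverse `w`,
where `R = s w` (`sqrt_mul_eq_resolvent`). Then `w ∈ M(A)`, and membership and density pass from `s`
and `w` to `R` and `R*`. -/

theorem isBoundedInverse_subScalar_iff {t : H →ₗ.[ℂ] H} {μ : ℂ} {R : H →L[ℂ] H} :
    IsBoundedInverse (subScalar t μ) R ↔
      (∀ y, (R y, y + μ • R y) ∈ t.graph) ∧ ∀ x w, (x, w) ∈ t.graph → R (w - μ • x) = x := by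
  constructor
  · rintro ⟨h₁, h₂⟩
    refine ⟨fun y => ?_, fun x w hxw => ?_⟩
    · obtain ⟨h, hy⟩ := h₁ y
      have hy' : t ⟨R y, h⟩ - μ • R y = y := hy
      exact t.mem_graph_iff.2 ⟨⟨R y, h⟩, rfl, sub_eq_iff_eq_add.1 hy'⟩
    · obtain ⟨u, rfl, rfl⟩ := t.mem_graph_iff.1 hxw
      exact h₂ u
  · rintro ⟨h₁, h₂⟩
    refine ⟨fun y => ?_, fun x => h₂ x (t x) (t.mem_graph x)⟩
    obtain ⟨u, hu, hu'⟩ := t.mem_graph_iff.1 (h₁ y)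
    have hu : (u : H) = R y := hu
    refine ⟨hu ▸ u.2, ?_⟩
    have : u = ⟨R y, hu ▸ u.2⟩ := Subtype.ext hu
    change t ⟨R y, _⟩ - μ • R y = y
    rw [← this]
    exact sub_eq_iff_eq_add.2 hu'

theorem isBoundedProduct_iff {t : H →ₗ.[ℂ] H} {s z : H →L[ℂ] H} :
    IsBoundedProduct t s z ↔ ∀ x, (s x, z x) ∈ t.graph := by
  refine forall_congr' fun x => ⟨fun ⟨h, hx⟩ => t.mem_graph_iff.2 ⟨⟨s x, h⟩, rfl, hx⟩, fun h => ?_⟩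
  obtain ⟨⟨u, hu⟩, rfl, hu'⟩ := t.mem_graph_iff.1 h
  exact ⟨hu, hu'⟩

theorem resolvent_eq {t : H →ₗ.[ℂ] H} {μ : ℂ} {R : H →L[ℂ] H}
    (hR : IsBoundedInverse (subScalar t μ) R) : resolvent t μ = R :=
  (isBoundedInverse_resolvent ⟨R, hR⟩).unique hR

theorem resolvent_mul_sub {t : H →ₗ.[ℂ] H} {μ : ℂ} {R s z : H →L[ℂ] H} (hR : IsBoundedInverse (subScalar t μ) R)
    (hz : IsBoundedProduct t s z) : R * (z - μ • s) = s := by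
  ext x
  exact (isBoundedInverse_subScalar_iff.1 hR).2 _ _ (isBoundedProduct_iff.1 hz x)

theorem IsBoundedInverse.injective {T : H →ₗ.[ℂ] H} {S : H →L[ℂ] H} (hS : IsBoundedInverse T S) :
    Function.Injective S := by
  intro x y hxy
  obtain ⟨h, hx⟩ := hS.1 x
  obtain ⟨h', hy⟩ := hS.1 y
  rw [← hx, ← hy]
  exact congrArg T (Subtype.ext hxy)

variable [CompleteSpace H]

theorem mem_graph_adjoint_iff {t : H →ₗ.[ℂ] H} (ht : Dense (t.domain : Set H)) {y w : H} :
    (y, w) ∈ t.adjoint.graph ↔ ∀ x v, (x, v) ∈ t.graph → ⟪w, x⟫_ℂ = ⟪y, v⟫_ℂ := by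
  constructor
  · rintro h x v hxv
    obtain ⟨y, rfl, rfl⟩ := LinearPMap.mem_graph_iff _ |>.1 h
    obtain ⟨x, rfl, rfl⟩ := t.mem_graph_iff.1 hxv
    exact LinearPMap.adjoint_isFormalAdjoint ht y x
  · intro h
    have h' : ∀ x : t.domain, ⟪w, x⟫_ℂ = ⟪y, t x⟫_ℂ := fun x => h x (t x) (t.mem_graph x)
    refine LinearPMap.mem_graph_iff _ |>.2
      ⟨⟨y, LinearPMap.mem_adjoint_domain_of_exists y ⟨w, h'⟩⟩, rfl, ?_⟩
    exact LinearPMap.adjoint_apply_eq ht _ h'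

theorem isBoundedInverse_oneAddAdjointMul_iff {t : H →ₗ.[ℂ] H} {r : H →L[ℂ] H} :
    IsBoundedInverse (oneAddAdjointMul t) r ↔
      (∀ y, ∃ w, (r y, w) ∈ t.graph ∧ (w, y - r y) ∈ t.adjoint.graph) ∧
        ∀ x w v, (x, w) ∈ t.graph → (w, v) ∈ t.adjoint.graph → r (x + v) = x := by
  constructor
  · rintro ⟨h₁, h₂⟩
    refine ⟨fun y => ?_, fun x w v hxw hwv => ?_⟩
    · obtain ⟨⟨h, h'⟩, hy⟩ := h₁ y
      have hy' : r y + t.adjoint ⟨t ⟨r y, h⟩, h'⟩ = y := hy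
      exact ⟨t ⟨r y, h⟩, t.mem_graph ⟨r y, h⟩,
        (LinearPMap.mem_graph_iff _).2 ⟨⟨_, h'⟩, rfl, eq_sub_of_add_eq' hy'⟩⟩
    · obtain ⟨⟨x, hx⟩, rfl, rfl⟩ := t.mem_graph_iff.1 hxw
      obtain ⟨⟨w, hw⟩, hw', rfl⟩ := (LinearPMap.mem_graph_iff _).1 hwv
      obtain rfl : w = t ⟨x, hx⟩ := hw'
      exact h₂ ⟨x, hx, hw⟩
  · rintro ⟨h₁, h₂⟩
    refine ⟨fun y => ?_, fun ⟨x, hx, hx'⟩ => h₂ x _ _ (t.mem_graph ⟨x, hx⟩)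
      (t.adjoint.mem_graph ⟨_, hx'⟩)⟩
    obtain ⟨w, hw, hw'⟩ := h₁ y
    obtain ⟨⟨x, hx⟩, hxr, rfl⟩ := t.mem_graph_iff.1 hw
    obtain rfl : x = r y := hxr
    obtain ⟨⟨v, hv⟩, hv', hv''⟩ := (LinearPMap.mem_graph_iff _).1 hw'
    obtain rfl : v = t ⟨r y, hx⟩ := hv'
    exact ⟨⟨hx, hv⟩, add_eq_of_eq_sub' hv''⟩

/-- The adjoint of the resolvent of `t` at `μ` is the resolvent of `t.adjoint` at `conj μ`. -/
theorem IsBoundedInverse.star_subScalar {t : H →ₗ.[ℂ] H} (ht : Dense (t.domain : Set H)) {μ : ℂ}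
    {R : H →L[ℂ] H} (hR : IsBoundedInverse (subScalar t μ) R) :
    IsBoundedInverse (subScalar t.adjoint (starRingEnd ℂ μ)) (star R) := by
  obtain ⟨h₁, h₂⟩ := isBoundedInverse_subScalar_iff.1 hR
  refine isBoundedInverse_subScalar_iff.2 ⟨fun y => ?_, fun x w hxw => ?_⟩
  · refine (mem_graph_adjoint_iff ht).2 fun x v hxv => ?_
    have h := h₂ x v hxv
    rw [map_sub, map_smul, sub_eq_iff_eq_add] at h
    rw [ContinuousLinearMap.star_eq_adjoint, ContinuousLinearMap.adjoint_inner_left, h]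
    simp [inner_add_right, inner_smul_right, ContinuousLinearMap.adjoint_inner_left, mul_comm]
  · refine ext_inner_right ℂ fun y => ?_
    have h := (mem_graph_adjoint_iff ht).1 hxw _ _ (h₁ y)
    rw [ContinuousLinearMap.star_eq_adjoint, ContinuousLinearMap.adjoint_inner_left,
      inner_sub_left, h]
    simp [inner_smul_left]

/-! ### The Gram operator and the formula for `(I + t* t)⁻¹` -/

/-- The Gram operator `R* R + (1 + μ R)* (1 + μ R)` of the graph parametrization
`u ↦ (R u, u + μ R u)`. -/
def graphGram (μ : ℂ) (R : H →L[ℂ] H) : H →L[ℂ] H :=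
  star R * R + star (1 + μ • R) * (1 + μ • R)

theorem isUnit_graphGram (μ : ℂ) (R : H →L[ℂ] H) : IsUnit (graphGram μ R) := by
  set B : H →L[ℂ] H := 1 + μ • R with hB
  -- The parallelogram law for `B` and `μ R`, whose difference is 1, bounds 1 by `2 B* B + 2 |μ|² R*
  -- R`; `K` dominates both coefficients.
  set K : ℝ := 2 * (1 + ‖μ‖ ^ 2) with hK
  have hK0 : 0 < K := by positivity
  have hμ : star μ * μ = ((‖μ‖ ^ 2 : ℝ) : ℂ) := by
    simpa using Complex.conj_mul' μ
  have key : K • graphGram μ R - 1 = star (B + μ • R) * (B + μ • R)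
      + ((2 : ℝ) • (star R * R) + (2 * ‖μ‖ ^ 2) • (star B * B)) := by
    have h1 : (1 : H →L[ℂ] H) = star (B - μ • R) * (B - μ • R) := by simp [hB]
    have h2 : star (μ • R) * (μ • R) = (‖μ‖ ^ 2 : ℝ) • (star R * R) := by
      rw [star_smul, smul_mul_smul_comm, hμ]
      exact Complex.coe_smul _ _
    have h3 : graphGram μ R = star R * R + star B * B := rfl
    have h4 : ∀ X Y : H →L[ℂ] H, star (X - Y) * (X - Y) + star (X + Y) * (X + Y)
        = (2 : ℝ) • (star X * X) + (2 : ℝ) • (star Y * Y) := fun X Y => by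
      simp only [star_sub, star_add, two_smul]
      noncomm_ring
    have h5 := h4 B (μ • R)
    rw [← h1, h2, ← eq_sub_iff_add_eq'] at h5
    rw [h3, hK, h5]
    module
  have hle : (1 : H →L[ℂ] H) ≤ K • graphGram μ R := by
    rw [← sub_nonneg, key]
    have := star_mul_self_nonneg (B + μ • R)
    have := star_mul_self_nonneg R
    have := star_mul_self_nonneg B
    positivity
  have hu := CStarAlgebra.isUnit_of_le 1 hle
  have := hu.smul (Units.mk0 K⁻¹ (by positivity))
  rwa [Units.smul_mk0, inv_smul_smul₀ hK0.ne'] at this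

variable {t : H →ₗ.[ℂ] H} {μ : ℂ} {R G' : H →L[ℂ] H}

/-- The formula `(I + t* t)⁻¹ = R G⁻¹ R*` in terms of the resolvent `R` and the Gram operator `G`. -/
theorem isBoundedInverse_mul_graphGram_inv (ht : Dense (t.domain : Set H))
    (hR : IsBoundedInverse (subScalar t μ) R) (hG : graphGram μ R * G' = 1) :
    IsBoundedInverse (oneAddAdjointMul t) (R * G' * star R) := by
  obtain ⟨h₁, h₂⟩ := isBoundedInverse_subScalar_iff.1 hR
  have hmem : ∀ y, ∃ w, ((R * G' * star R) y, w) ∈ t.graph ∧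
      (w, y - (R * G' * star R) y) ∈ t.adjoint.graph := by
    intro y
    set u := G' (star R y) with hu
    refine ⟨_, h₁ u, (mem_graph_adjoint_iff ht).2 fun x v hxv => ?_⟩
    have hx := h₂ x v hxv
    obtain ⟨e, rfl, rfl⟩ : ∃ e, x = R e ∧ v = e + μ • R e :=
      ⟨v - μ • x, hx.symm, by rw [hx, sub_add_cancel]⟩
    have h : graphGram μ R u = star R y := by
      rw [hu, ← mul_apply_eq_comp, hG, one_apply_eq_self]
    have h' := congrArg (fun a => ⟪a, e⟫_ℂ) h
    simp only [graphGram, add_apply, mul_apply_eq_comp,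
      ContinuousLinearMap.star_eq_adjoint, inner_add_left,
      ContinuousLinearMap.adjoint_inner_left, smul_apply, one_apply_eq_self] at h'
    change ⟪y - R u, R e⟫_ℂ = _
    rw [inner_sub_left, ← h', add_sub_cancel_left, inner_add_left]
  refine isBoundedInverse_oneAddAdjointMul_iff.2 ⟨hmem, fun x w v hxw hwv => ?_⟩
  -- The difference `p` of two solutions satisfies `(p, q) ∈ t.graph` and `(q, -p) ∈
  -- t.adjoint.graph`, so `-‖p‖² = ‖q‖²`.
  obtain ⟨w', hw', hv'⟩ := hmem (x + v)
  set x' := (R * G' * star R) (x + v)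
  have hg : (x' - x, w' - w) ∈ t.graph := t.graph.sub_mem hw' hxw
  have hg' : (w' - w, x + v - x' - v) ∈ t.adjoint.graph := t.adjoint.graph.sub_mem hv' hwv
  have h := (mem_graph_adjoint_iff ht).1 hg' _ _ hg
  have e : x + v - x' - v = -(x' - x) := by abel
  rw [e, inner_neg_left, inner_self_eq_norm_sq_to_K, inner_self_eq_norm_sq_to_K] at h
  have h'' : -‖x' - x‖ ^ 2 = ‖w' - w‖ ^ 2 := by exact_mod_cast h
  have : ‖x' - x‖ = 0 := by nlinarith [sq_nonneg ‖w' - w‖, sq_nonneg ‖x' - x‖]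
  exact sub_eq_zero.1 (norm_eq_zero.1 this)

/-! ### The square root of `(I + t* t)⁻¹` and the bounded transform -/

theorem IsBoundedInverse.nonneg (ht : Dense (t.domain : Set H)) {r : H →L[ℂ] H}
    (hr : IsBoundedInverse (oneAddAdjointMul t) r) : 0 ≤ r := by
  rw [ContinuousLinearMap.nonneg_iff_isPositive, ContinuousLinearMap.isPositive_iff_complex]
  intro y
  obtain ⟨w, hw, hw'⟩ := (isBoundedInverse_oneAddAdjointMul_iff.1 hr).1 y
  have h := (mem_graph_adjoint_iff ht).1 hw' _ _ hw
  have h2 : ⟪r y, y⟫_ℂ = ((‖r y‖ ^ 2 + ‖w‖ ^ 2 : ℝ) : ℂ) := by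
    rw [← inner_conj_symm, ← sub_add_cancel y (r y), inner_add_left, sub_add_cancel, h,
      inner_self_eq_norm_sq_to_K, inner_self_eq_norm_sq_to_K]
    simp [add_comm]
  rw [h2]
  refine ⟨by rw [RCLike.re_to_complex, Complex.ofReal_re], ?_⟩
  rw [RCLike.re_to_complex, Complex.ofReal_re]
  positivity

theorem inner_sqrt_apply {r : H →L[ℂ] H} (x y : H) :
    ⟪CFC.sqrt r x, y⟫_ℂ = ⟪x, CFC.sqrt r y⟫_ℂ := by
  have h : star (CFC.sqrt r) = CFC.sqrt r := (CFC.sqrt_nonneg r).isSelfAdjoint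
  nth_rewrite 1 [← h]
  rw [ContinuousLinearMap.star_eq_adjoint, ContinuousLinearMap.adjoint_inner_left]

theorem sqrt_apply_sqrt_apply {r : H →L[ℂ] H} (hr : 0 ≤ r) (x : H) :
    CFC.sqrt r (CFC.sqrt r x) = r x := by
  rw [← mul_apply_eq_comp, CFC.sqrt_mul_sqrt_self r hr]

/-- The orthogonal complement of the range is the kernel of the self-adjoint `√r`, which lies in the
trivial kernel of `r`. -/
theorem denseRange_sqrt (ht : Dense (t.domain : Set H)) {r : H →L[ℂ] H}
    (hr : IsBoundedInverse (oneAddAdjointMul t) r) : DenseRange (CFC.sqrt r : H →L[ℂ] H) := by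
  have hr0 := hr.nonneg ht
  have hker : (CFC.sqrt r).range.topologicalClosure = ⊤ := by
    rw [Submodule.topologicalClosure_eq_top_iff, Submodule.eq_bot_iff]
    intro y hy
    have hsy : CFC.sqrt r y = 0 := by
      refine ext_inner_left ℂ fun x => ?_
      rw [← inner_sqrt_apply, inner_zero_right]
      exact (Submodule.mem_orthogonal _ _).1 hy _ ⟨x, rfl⟩
    have hry : r y = 0 := by rw [← sqrt_apply_sqrt_apply hr0, hsy, map_zero]
    obtain ⟨h, hy⟩ := hr.1 y
    have : (⟨r y, h⟩ : (oneAddAdjointMul t).domain) = 0 := Subtype.ext hry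
    rw [this, LinearPMap.map_zero] at hy
    exact hy.symm
  have := Submodule.dense_iff_topologicalClosure_eq_top.2 hker
  exact this

/-- Existence of the bounded transform of a closed operator. -/
theorem exists_isBoundedProduct_sqrt (ht : Dense (t.domain : Set H)) (htc : t.IsClosed)
    {r T : H →L[ℂ] H} (hr : IsBoundedInverse (oneAddAdjointMul t) r)
    (hT : IsBoundedProduct t r T) :
    ∃ z, IsBoundedProduct t (CFC.sqrt r) z ∧ z * CFC.sqrt r = T := by
  have hr0 := hr.nonneg ht
  have hd := denseRange_sqrt ht hr
  have hT' := isBoundedProduct_iff.1 hT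
  -- From `‖T y‖² = ⟪y - r y, r y⟫ = ‖√r y‖² - ‖r y‖²`. Hence `√r y ↦ T y` extends continuously to
  -- `H`.
  have hbound : ∀ y, ‖T y‖ ≤ 1 * ‖CFC.sqrt r y‖ := by
    intro y
    obtain ⟨w, hw, hw'⟩ := (isBoundedInverse_oneAddAdjointMul_iff.1 hr).1 y
    obtain rfl : w = T y := LinearPMap.mem_graph_snd_inj _ hw (hT' y) rfl
    have h := (mem_graph_adjoint_iff ht).1 hw' _ _ hw
    rw [inner_sub_left, inner_self_eq_norm_sq_to_K, inner_self_eq_norm_sq_to_K,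
      ← sqrt_apply_sqrt_apply hr0, ← inner_sqrt_apply, inner_self_eq_norm_sq_to_K,
      sqrt_apply_sqrt_apply hr0] at h
    have h' : ‖CFC.sqrt r y‖ ^ 2 - ‖r y‖ ^ 2 = ‖T y‖ ^ 2 := by exact_mod_cast h
    rw [one_mul]
    exact le_of_sq_le_sq (by linarith [sq_nonneg ‖r y‖]) (norm_nonneg _)
  let z := T.toLinearMap.extendOfNorm (CFC.sqrt r : H →L[ℂ] H).toLinearMap
  have hz : ∀ y, z (CFC.sqrt r y) = T y := LinearMap.extendOfNorm_eq hd ⟨1, hbound⟩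
  refine ⟨z, isBoundedProduct_iff.2 fun x => ?_, ContinuousLinearMap.ext hz⟩
  refine hd.induction_on (p := fun x => (CFC.sqrt r x, z x) ∈ t.graph) x ?_ fun y => ?_
  · exact IsClosed.preimage (f := fun x => (CFC.sqrt r x, z x)) (by fun_prop) htc
  · rw [hz, sqrt_apply_sqrt_apply hr0]
    exact hT' y

/-- The inverse of `z - μ s` is `s R + z* (1 + μ R)`, where `s` is the square root of `(I + t* t)⁻¹`
and `z` the bounded transform. -/
theorem sqrt_mul_eq_resolvent (ht : Dense (t.domain : Set H)) {r z : H →L[ℂ] H}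
    (hR : IsBoundedInverse (subScalar t μ) R) (hr : IsBoundedInverse (oneAddAdjointMul t) r)
    (hz : IsBoundedProduct t (CFC.sqrt r) z) :
    CFC.sqrt r * (CFC.sqrt r * R + star z * (1 + μ • R)) = R := by
  have hr0 := hr.nonneg ht
  have hz := isBoundedProduct_iff.1 hz
  ext u
  refine ext_inner_right ℂ fun y => ?_
  -- The identity comes from pairing `(R u, u + μ R u)` in the graph of `t` with `(z √r y, y - r y)`
  -- in that of `t.adjoint`.
  have hu := (isBoundedInverse_subScalar_iff.1 hR).1 u
  obtain ⟨w, hw, hw'⟩ := (isBoundedInverse_oneAddAdjointMul_iff.1 hr).1 y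
  have hzw := hz (CFC.sqrt r y)
  rw [sqrt_apply_sqrt_apply hr0] at hzw
  obtain rfl : w = z (CFC.sqrt r y) := LinearPMap.mem_graph_snd_inj _ hw hzw rfl
  have h := congrArg (starRingEnd ℂ) ((mem_graph_adjoint_iff ht).1 hw' _ _ hu)
  rw [inner_conj_symm, inner_conj_symm, inner_sub_right, sub_eq_iff_eq_add] at h
  rw [h, ← sqrt_apply_sqrt_apply hr0]
  simp only [mul_apply_eq_comp, inner_sqrt_apply, add_apply,
    inner_add_left, ContinuousLinearMap.star_eq_adjoint, ContinuousLinearMap.adjoint_inner_left,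
    one_apply_eq_self, smul_apply]
  ring

end UnboundedOperator

namespace OperatorAlgebra

open UnboundedOperator

variable {H : Type*} [NormedAddCommGroup H] [InnerProductSpace ℂ H] [CompleteSpace H]
  {A : NonUnitalStarSubalgebra ℂ (H →L[ℂ] H)}

/-! ### The multiplier algebra and density of `x A` -/

theorem mul_star_mem {x : H →L[ℂ] H}
    (hx : ∀ a ∈ A, x * a ∈ A) {a : H →L[ℂ] H} (ha : a ∈ A) : a * star x ∈ A := by
  simpa using star_mem (hx (star a) (star_mem ha))

/-- The multiplier algebra as a unital star subalgebra. -/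
def multiplierStarSubalgebra (A : NonUnitalStarSubalgebra ℂ (H →L[ℂ] H)) :
    StarSubalgebra ℂ (H →L[ℂ] H) where
  carrier := multiplierAlgebra A
  mul_mem' {x y} hx hy a ha :=
    ⟨by rw [mul_assoc]; exact (hx _ (hy a ha).1).1, by
      rw [← mul_assoc]; exact (hy _ (hx a ha).2).2⟩
  add_mem' {x y} hx hy a ha :=
    ⟨by rw [add_mul]; exact add_mem (hx a ha).1 (hy a ha).1, by
      rw [mul_add]; exact add_mem (hx a ha).2 (hy a ha).2⟩
  algebraMap_mem' c a ha := by
    simp only [Algebra.algebraMap_eq_smul_one, smul_mul_assoc, mul_smul_comm, one_mul, mul_one]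
    exact ⟨SMulMemClass.smul_mem c ha, SMulMemClass.smul_mem c ha⟩
  star_mem' {x} hx a ha :=
    ⟨by simpa using star_mem (hx (star a) (star_mem ha)).2,
      mul_star_mem (fun b hb => (hx b hb).1) ha⟩

theorem isClosed_multiplierStarSubalgebra (hA : IsClosed (A : Set (H →L[ℂ] H))) :
    IsClosed (multiplierStarSubalgebra A : Set (H →L[ℂ] H)) := by
  have : (multiplierStarSubalgebra A : Set (H →L[ℂ] H)) =
      ⋂ a ∈ A, ((fun x => x * a) ⁻¹' A ∩ (fun x => a * x) ⁻¹' A) := by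
    ext x
    simp [multiplierStarSubalgebra, multiplierAlgebra]
  rw [this]
  exact isClosed_biInter fun a _ =>
    (hA.preimage (by fun_prop)).inter (hA.preimage (by fun_prop))

theorem sqrt_mem {M : StarSubalgebra ℂ (H →L[ℂ] H)} (hM : IsClosed (M : Set (H →L[ℂ] H)))
    {r : H →L[ℂ] H} (hr : r ∈ M) (hr0 : 0 ≤ r) : CFC.sqrt r ∈ M := by
  have : IsClosed (M : Set (H →L[ℂ] H)) := hM
  rw [CFC.sqrt_eq_real_sqrt r hr0]
  exact cfcₙ_mem (𝕜' := ℂ) _ hr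

/-- Spectral permanence: invertibility in `B(H)` descends to a closed star subalgebra. -/
theorem inverse_mem {M : StarSubalgebra ℂ (H →L[ℂ] H)} (hM : IsClosed (M : Set (H →L[ℂ] H)))
    {x y : H →L[ℂ] H} (hx : x ∈ M) (hxy : x * y = 1) (hyx : y * x = 1) : y ∈ M := by
  have : IsClosed (M : Set (H →L[ℂ] H)) := hM
  have hu : IsUnit (x : H →L[ℂ] H) := ⟨⟨x, y, hxy, hyx⟩, rfl⟩
  obtain ⟨v, hv⟩ := (M.coe_isUnit (a := ⟨x, hx⟩)).1 hu
  have h : ((v⁻¹ : Mˣ) : M) * v = 1 := v.inv_mul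
  rw [hv] at h
  have h' : (((v⁻¹ : Mˣ) : M) : H →L[ℂ] H) * x = 1 := congrArg Subtype.val h
  rw [← left_inv_eq_right_inv h' hxy]
  exact Subtype.prop _

theorem MulDense.mul_mem {x a : H →L[ℂ] H} (hx : MulDense x A) (ha : a ∈ A) : x * a ∈ A := by
  have : x * a ∈ closure ((fun a => x * a) '' (A : Set (H →L[ℂ] H))) :=
    subset_closure ⟨a, ha, rfl⟩
  rwa [hx] at this

theorem mulDense_of_subset (hA : IsClosed (A : Set (H →L[ℂ] H))) {x : H →L[ℂ] H}
    (hx : ∀ a ∈ A, x * a ∈ A)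
    (h : (A : Set (H →L[ℂ] H)) ⊆ closure ((fun a => x * a) '' (A : Set (H →L[ℂ] H)))) :
    MulDense x A :=
  (closure_minimal (by rintro _ ⟨a, ha, rfl⟩; exact hx a ha) hA).antisymm h

theorem MulDense.mul (hA : IsClosed (A : Set (H →L[ℂ] H))) {x y : H →L[ℂ] H}
    (hx : MulDense x A) (hy : MulDense y A) : MulDense (x * y) A := by
  refine mulDense_of_subset hA (fun a ha => ?_) ?_
  · rw [mul_assoc]
    exact hx.mul_mem (hy.mul_mem ha)
  · nth_rewrite 1 [← hx]
    refine closure_minimal ?_ isClosed_closure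
    nth_rewrite 1 [← hy]
    refine (image_closure_subset_closure_image (by fun_prop)).trans (closure_mono ?_)
    rintro _ ⟨_, ⟨a, ha, rfl⟩, rfl⟩
    exact ⟨a, ha, mul_assoc _ _ _⟩

theorem MulDense.of_mul (hA : IsClosed (A : Set (H →L[ℂ] H))) {x y : H →L[ℂ] H}
    (hx : ∀ a ∈ A, x * a ∈ A) (hy : ∀ a ∈ A, y * a ∈ A) (hxy : MulDense (x * y) A) :
    MulDense x A := by
  refine mulDense_of_subset hA hx ?_
  nth_rewrite 1 [← hxy]
  refine closure_mono ?_
  rintro _ ⟨a, ha, rfl⟩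
  exact ⟨y * a, hy a ha, (mul_assoc _ _ _).symm⟩

theorem mulDense_of_mul_eq_one (hA : IsClosed (A : Set (H →L[ℂ] H))) {x y : H →L[ℂ] H}
    (hx : ∀ a ∈ A, x * a ∈ A) (hy : ∀ a ∈ A, y * a ∈ A) (hxy : x * y = 1) : MulDense x A := by
  refine mulDense_of_subset hA hx fun a ha => subset_closure ⟨y * a, hy a ha, ?_⟩
  simp [← mul_assoc, hxy]

/-- Density cancels `y`: left multiplication by `x` sends `y A` into the closed set `A`, hence also
its closure. -/
theorem MulDense.mul_mem_of_mul (hA : IsClosed (A : Set (H →L[ℂ] H))) {x y : H →L[ℂ] H}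
    (hy : MulDense y A) (hxy : ∀ a ∈ A, x * y * a ∈ A) {a : H →L[ℂ] H} (ha : a ∈ A) :
    x * a ∈ A := by
  have hsub : closure ((fun a => y * a) '' (A : Set (H →L[ℂ] H))) ⊆ (fun b => x * b) ⁻¹' A := by
    refine closure_minimal ?_ (hA.preimage (by fun_prop))
    rintro _ ⟨b, hb, rfl⟩
    simpa [mul_assoc] using hxy b hb
  rw [hy] at hsub
  exact hsub ha

/-! ### The two implications -/

variable {t : H →ₗ.[ℂ] H} {μ : ℂ} {R : H →L[ℂ] H}

theorem IsAffiliated.mem_and_mulDense (hA : IsClosed (A : Set (H →L[ℂ] H)))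
    (hR : IsBoundedInverse (subScalar t μ) R) (h : IsAffiliated t A) :
    R ∈ multiplierAlgebra A ∧ MulDense R A ∧ MulDense (star R) A := by
  obtain ⟨ht, -, r, z, hr, hz, hzM, hrA⟩ := h
  have hM := isClosed_multiplierStarSubalgebra hA
  set M := multiplierStarSubalgebra A
  have hr0 := hr.nonneg ht
  set s := CFC.sqrt r with hs
  have hs_star : star s = s := (CFC.sqrt_nonneg r).isSelfAdjoint
  have hss : s * s = r := CFC.sqrt_mul_sqrt_self r hr0
  have hrM : r ∈ M := fun a ha => ⟨hrA.mul_mem ha, by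
    have hr_star : star r = r := hr0.isSelfAdjoint
    rw [← hr_star]
    exact mul_star_mem (fun b hb => hrA.mul_mem hb) ha⟩
  have hsM : s ∈ M := sqrt_mem hM hrM hr0
  have hzM : z ∈ M := hzM
  set w := s * R + star z * (1 + μ • R) with hw
  have hsw : s * w = R := sqrt_mul_eq_resolvent ht hR hr hz
  have hRv : R * (z - μ • s) = s := resolvent_mul_sub hR hz
  have hs_inj : ∀ {a b : H →L[ℂ] H}, s * a = s * b → a = b := by
    intro a b hab
    ext y
    refine hr.injective ?_
    have := congrArg (fun c => (s * c) y) hab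
    simp only [← mul_assoc, hss] at this
    exact this
  -- `s w v = R v = s` and `R v w = s w = R`; the injective factors `s` and `R` cancel on the left.
  have hwv : w * (z - μ • s) = 1 := hs_inj (by rw [← mul_assoc, hsw, hRv, mul_one])
  have hvw : (z - μ • s) * w = 1 := by
    ext y
    refine hR.injective ?_
    have : R * ((z - μ • s) * w) = R * 1 := by rw [← mul_assoc, hRv, hsw, mul_one]
    exact congrArg (fun c => c y) this
  have hvM : z - μ • s ∈ M := sub_mem hzM (SMulMemClass.smul_mem μ hsM)
  have hwM : w ∈ M := inverse_mem hM hvM hvw hwv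
  have hsA : MulDense s A := by
    rw [← hss] at hrA
    exact hrA.of_mul hA (fun a ha => (hsM a ha).1) (fun a ha => (hsM a ha).1)
  have hwA : MulDense w A :=
    mulDense_of_mul_eq_one hA (fun a ha => (hwM a ha).1) (fun a ha => (hvM a ha).1) hwv
  have hwA' : MulDense (star w) A :=
    mulDense_of_mul_eq_one hA (fun a ha => (star_mem hwM a ha).1)
      (fun a ha => (star_mem hvM a ha).1) (by rw [← star_mul, hvw, star_one])
  have hstar : star R = star w * s := by rw [← hsw, star_mul, hs_star]
  exact ⟨hsw ▸ mul_mem hsM hwM, hsw ▸ hsA.mul hA hwA, hstar ▸ hwA'.mul hA hsA⟩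

theorem isAffiliated_of_mem (hA : IsClosed (A : Set (H →L[ℂ] H)))
    (ht : Dense (t.domain : Set H)) (htc : t.IsClosed)
    (hR : IsBoundedInverse (subScalar t μ) R) (hRM : R ∈ multiplierAlgebra A)
    (hRA : MulDense R A) (hRA' : MulDense (star R) A) : IsAffiliated t A := by
  have hM := isClosed_multiplierStarSubalgebra hA
  set M := multiplierStarSubalgebra A
  have hRM : R ∈ M := hRM
  have hBM : 1 + μ • R ∈ M := add_mem (one_mem _) (SMulMemClass.smul_mem μ hRM)
  have hGM : graphGram μ R ∈ M :=
    add_mem (mul_mem (star_mem hRM) hRM) (mul_mem (star_mem hBM) hBM)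
  obtain ⟨⟨G, G', hGG', hG'G⟩, hG⟩ := isUnit_graphGram μ R
  obtain rfl : G = graphGram μ R := hG
  have hG'M : G' ∈ M := inverse_mem hM hGM hGG' hG'G
  have hG'A : MulDense G' A :=
    mulDense_of_mul_eq_one hA (fun a ha => (hG'M a ha).1) (fun a ha => (hGM a ha).1) hG'G
  have hr := isBoundedInverse_mul_graphGram_inv ht hR hGG'
  have hrM : R * G' * star R ∈ M := mul_mem (mul_mem hRM hG'M) (star_mem hRM)
  have hrA : MulDense (R * G' * star R) A := (hRA.mul hA hG'A).mul hA hRA'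
  have hT : IsBoundedProduct t (R * G' * star R) ((1 + μ • R) * G' * star R) :=
    isBoundedProduct_iff.2 fun y => (isBoundedInverse_subScalar_iff.1 hR).1 (G' (star R y))
  have hTM : (1 + μ • R) * G' * star R ∈ M := mul_mem (mul_mem hBM hG'M) (star_mem hRM)
  set r := R * G' * star R with hr_def
  have hr0 := hr.nonneg ht
  obtain ⟨z, hz, hzs⟩ := exists_isBoundedProduct_sqrt ht htc hr hT
  have hsM : CFC.sqrt r ∈ M := sqrt_mem hM hrM hr0
  have hsA : MulDense (CFC.sqrt r) A := by
    refine MulDense.of_mul hA (fun a ha => (hsM a ha).1) (fun a ha => (hsM a ha).1) ?_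
    rwa [CFC.sqrt_mul_sqrt_self r hr0]
  have hRzM : R * z ∈ M := by
    have h := resolvent_mul_sub hR hz
    rw [mul_sub, sub_eq_iff_eq_add] at h
    rw [h]
    exact add_mem hsM (mul_mem hRM (SMulMemClass.smul_mem μ hsM))
  refine ⟨ht, htc, r, z, hr, hz, fun a ha => ⟨?_, ?_⟩, hrA⟩
  · exact hsA.mul_mem_of_mul hA (fun b hb => by rw [hzs]; exact (hTM b hb).1) ha
  · have h : ∀ b ∈ A, star z * b ∈ A := fun b hb =>
      hRA'.mul_mem_of_mul hA (fun c hc => by rw [← star_mul]; exact (star_mem hRzM c hc).1) hb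
    simpa using mul_star_mem h ha

end OperatorAlgebra

end

theorem theorem5p9 {H : Type*} [NormedAddCommGroup H] [InnerProductSpace ℂ H] [CompleteSpace H]
    (A : NonUnitalStarSubalgebra ℂ (H →L[ℂ] H)) (hA : IsClosed (A : Set (H →L[ℂ] H)))
    (hA_nondeg : OperatorAlgebra.Nondegenerate A)
    (t : H →ₗ.[ℂ] H) (ht_dense : Dense (t.domain : Set H)) (ht_closed : t.IsClosed)
    (μ : ℂ) (hμ : μ ∈ UnboundedOperator.resolventSet t) :
    OperatorAlgebra.IsAffiliated t A ↔
      UnboundedOperator.resolvent t μ ∈ OperatorAlgebra.multiplierAlgebra A ∧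
      OperatorAlgebra.MulDense (UnboundedOperator.resolvent t μ) A ∧
      OperatorAlgebra.MulDense
        (UnboundedOperator.resolvent t.adjoint ((starRingEnd ℂ) μ)) A := by
  have hR := UnboundedOperator.isBoundedInverse_resolvent hμ
  rw [UnboundedOperator.resolvent_eq (hR.star_subScalar ht_dense)]
  exact ⟨fun h => h.mem_and_mulDense hA hR, fun ⟨h₁, h₂, h₃⟩ =>
    OperatorAlgebra.isAffiliated_of_mem hA ht_dense ht_closed hR h₁ h₂ h₃⟩
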